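/- All digraphs are finite, without loops and multiple arcs. For $0\le\alpha<1$ and a digraph $G$ let $A_\alpha(G)=\alpha D(G)+(1-\alpha)A(G)$, where $A(G)$ is the adjacency matrix of $G$ (with entry $1$ at $(v,w)$ if there is an arc from $v$ to $w$, and $0$ otherwise) and $D(G)$ is the diagonal matrix of the outdegrees of $G$, and let $\rho_\alpha(G)$ be the spectral radius of $A_\alpha(G)$. Let $\overrightarrow{C}_n$ denote the directed cycle on $n$ vertices. Let $G$ be a strongly connected digraph with at least two vertices and let $u$ be a vertex of $G$. For $p,q\ge 2$ let $C_p\cdot C_q\cdot G$ denote any digraph obtained from the disjoint union of $\overrightarrow{C}_p$, $\overrightarrow{C}_q$ and $G$ by identifying a vertex of $\overrightarrow{C}_p$ with a vertex of $\overrightarrow{C}_q$ and identifying the vertex $u$ of $G$ with another vertex of $\overrightarrow{C}_q$; thus in $C_q\cdot C_p\cdot G$ the vertex $u$ is identified with a vertex of $\overrightarrow{C}_p$ other than the one shared by the two cycles. If $p>q\ge 2$ and $0\le\alpha<1$, then $$\rho_\alpha(C_p\cdot C_q\cdot G)>\rho_\alpha(C_q\cdot C_p\cdot G),$$ for every choice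 of the identified vertices of the cycles in the two digraphs. -/

import Mathlib

open scoped ENNReal

namespace Digraph

variable {V W : Type*}

/-- A digraph has no loops (multiple arcs are impossible for a `Digraph`). -/
def Loopless (G : Digraph V) : Prop :=
  ∀ v, ¬ G.Adj v v

/-- For all vertices `u`, `v` there is a directed path from `u` to `v` (hence also one back). -/
def StronglyConnected (G : Digraph V) : Prop :=
  ∀ u v, Relation.ReflTransGen G.Adj u v

open Classical in
/-- The outdegree of a vertex. -/
noncomputable def outDeg [Fintype V] (G : Digraph V) (v : V) : ℕ :=
  (Finset.univ.filter fun w => G.Adj v w).card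

open Classical in
/-- The adjacency matrix: the entry at `(v, w)` is `1` if there is an arc from `v` to `w`,
and `0` otherwise. -/
noncomputable def adjMat (G : Digraph V) : Matrix V V ℝ :=
  Matrix.of fun v w => if G.Adj v w then 1 else 0

/-- `A_α(G) = α D(G) + (1 - α) A(G)`, where `D(G)` is the diagonal matrix of outdegrees. -/
noncomputable def alphaMat [Fintype V] [DecidableEq V] (α : ℝ) (G : Digraph V) :
    Matrix V V ℝ :=
  α • Matrix.diagonal (fun v => (G.outDeg v : ℝ)) + (1 - α) • G.adjMat

/-- The `α`-spectral radius of a digraph: the largest modulus of a complex eigenvalue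
of `A_α(G)`. -/
noncomputable def alphaSpectralRadius [Fintype V] [DecidableEq V] (α : ℝ) (G : Digraph V) :
    ℝ≥0∞ :=
  spectralRadius ℂ ((G.alphaMat α).map (fun x : ℝ => (x : ℂ)))

/-- The directed cycle on `n` vertices, with arcs `0 → 1 → ⋯ → n - 1 → 0`. -/
def dicycle (n : ℕ) : Digraph (Fin n) where
  Adj i j := (j : ℕ) = ((i : ℕ) + 1) % n

/-- The vertices of the second digraph inside a coalescence: the vertex `w₀` becomes the vertex
`v₀` of the first digraph, all other vertices are kept. -/
def coalRight [DecidableEq W] (v₀ : V) (w₀ : W) (w : W) : V ⊕ {w : W // w ≠ w₀} :=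
  if h : w = w₀ then Sum.inl v₀ else Sum.inr ⟨w, h⟩

/-- The coalescence of `G` and `H`: the disjoint union of the two digraphs with the vertex `v₀` of
`G` and the vertex `w₀` of `H` identified. Its arcs are the images of the arcs of `G` and `H`. -/
def coalescence [DecidableEq W] (G : Digraph V) (v₀ : V) (H : Digraph W) (w₀ : W) :
    Digraph (V ⊕ {w : W // w ≠ w₀}) where
  Adj x y :=
    (∃ a b, G.Adj a b ∧ x = Sum.inl a ∧ y = Sum.inl b) ∨
      (∃ a b, H.Adj a b ∧ x = coalRight v₀ w₀ a ∧ y = coalRight v₀ w₀ b)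

/-- The digraph `C_p · C_q · G`: the vertex `a` of the dicycle `C_p` is identified with the vertex
`b` of the dicycle `C_q`, and another vertex `c ≠ b` of `C_q` is identified with the vertex `u`
of `G`. -/
def cycleCycle [DecidableEq V] (p q : ℕ) (a : Fin p) (b c : Fin q) (hcb : c ≠ b)
    (G : Digraph V) (u : V) :
    Digraph ((Fin p ⊕ {x : Fin q // x ≠ b}) ⊕ {w : V // w ≠ u}) :=
  coalescence (coalescence (dicycle p) a (dicycle q) b) (Sum.inr ⟨c, hcb⟩) G u

end Digraph

/-! Let `r` be the eigenvalue of a positive eigenvector of `C_p · C_q · G`, and put `s = r - α`, `t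
= (1 - α) / s`. At a vertex of outdegree one on a cycle, the eigenvector is `t` times its value at
the next vertex, so only the value `X` at the shared vertex and the restriction `h` to `G` remain.
Eliminating `X`, the cycles contribute `s² h(u) t^q / (s(1 - t^p) - α)` to the equation at `u`. The
position of `u` on its cycle has dropped out.

Keep `s`, `t`, `h` and exchange the cycles: the contribution becomes `s² h(u) t^p / (s(1 - t^q) -
α)`. It is smaller, because the cross-multiplied difference is `(t^q - t^p)(s(1 - t^p - t^q) - α)`.
Both factors are positive, since `A_α(G) h` is positive at `u`. Hence `C_q · C_p · G` has a positive
vector satisfying the eigenvalue equation for `r` everywhere except at `u`, where it is strictly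
subinvariant, and irreducibility gives a spectral radius below `r`.

The carrying lemmas are `exists_reduced_eigenvector` and `alphaSpectralRadius_cycleCycle_lt`,
resting on `exists_pos_eigenvector` and `spectralRadius_lt_of_mulVec_le`. -/

namespace Matrix

/-! ### Perron–Frobenius theory for irreducible nonnegative matrices -/

variable {V : Type*} [Fintype V]

/-- The Collatz–Wielandt maximum of a nonnegative matrix is attained. -/
theorem exists_isMax_collatzWielandt [Nonempty V] (M : Matrix V V ℝ) (hM : ∀ i j, 0 ≤ M i j) :
    ∃ r : ℝ, (∃ x : V → ℝ, 0 ≤ x ∧ 0 < ∑ i, x i ∧ r • x ≤ M *ᵥ x) ∧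
      ∀ t : ℝ, ∀ x : V → ℝ, 0 ≤ x → 0 < ∑ i, x i → t • x ≤ M *ᵥ x → t ≤ r := by
  classical
  set C : ℝ := ∑ i, ∑ j, M i j with hC
  have hbound : ∀ t : ℝ, ∀ x ∈ stdSimplex ℝ V, t • x ≤ M *ᵥ x → t ≤ C := by
    intro t x hx h
    calc t = ∑ i, t * x i := by rw [← Finset.mul_sum, hx.2, mul_one]
      _ ≤ ∑ i, (M *ᵥ x) i := Finset.sum_le_sum fun i _ => h i
      _ ≤ C := by
        refine Finset.sum_le_sum fun i _ => Finset.sum_le_sum fun j _ => ?_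
        have hxj : x j ≤ 1 := by
          rw [← hx.2]
          exact Finset.single_le_sum (fun k _ => hx.1 k) (Finset.mem_univ j)
        exact mul_le_of_le_one_right (hM i j) hxj
  -- Cutting at `0` loses nothing: the maximum is nonnegative, so negative `t` are harmless.
  set S : Set (ℝ × (V → ℝ)) :=
    (Set.Icc 0 C ×ˢ stdSimplex ℝ V) ∩ {z | z.1 • z.2 ≤ M *ᵥ z.2} with hS
  have hScomp : IsCompact S := by
    refine (isCompact_Icc.prod (isCompact_stdSimplex ℝ V)).inter_right ?_
    refine isClosed_le (by fun_prop) ?_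
    exact (Continuous.matrix_mulVec continuous_const continuous_snd)
  have hmulnonneg : ∀ x : V → ℝ, 0 ≤ x → 0 ≤ M *ᵥ x := fun x hx i =>
    Finset.sum_nonneg fun j _ => mul_nonneg (hM i j) (hx j)
  have hSne : S.Nonempty := by
    obtain ⟨v⟩ := ‹Nonempty V›
    have hv := single_mem_stdSimplex ℝ v
    refine ⟨(0, Pi.single v 1), ⟨⟨⟨le_rfl, ?_⟩, hv⟩, ?_⟩⟩
    · exact Finset.sum_nonneg fun i _ => Finset.sum_nonneg fun j _ => hM i j
    · simpa using hmulnonneg _ hv.1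
  obtain ⟨⟨r, x⟩, hrx, hmax⟩ := hScomp.exists_isMaxOn hSne continuous_fst.continuousOn
  refine ⟨r, ⟨x, hrx.1.2.1, by rw [hrx.1.2.2]; exact one_pos, hrx.2⟩, fun t y hy hy0 hty => ?_⟩
  rcases lt_or_ge t 0 with ht | ht
  · exact ht.le.trans hrx.1.1.1
  set s := ∑ i, y i with hs
  have hyS : s⁻¹ • y ∈ stdSimplex ℝ V := by
    refine ⟨fun i => mul_nonneg (inv_nonneg.2 hy0.le) (hy i), ?_⟩
    simp only [Pi.smul_apply, smul_eq_mul]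
    rw [← Finset.mul_sum, inv_mul_cancel₀ hy0.ne']
  have hty' : t • s⁻¹ • y ≤ M *ᵥ (s⁻¹ • y) := by
    rw [mulVec_smul, smul_comm]
    exact smul_le_smul_of_nonneg_left hty (inv_nonneg.2 hy0.le)
  exact hmax (show (t, s⁻¹ • y) ∈ S from ⟨⟨⟨ht, hbound t _ hyS hty'⟩, hyS⟩, hty'⟩)

/-- A nonnegative irreducible matrix has a positive eigenvector. -/
theorem exists_pos_eigenvector [Nonempty V] (M : Matrix V V ℝ) (hM : ∀ i j, 0 ≤ M i j)
    (hirr : ∀ i j, Relation.ReflTransGen (fun a b => 0 < M a b) i j) :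
    ∃ (r : ℝ) (x : V → ℝ), (∀ i, 0 < x i) ∧ M *ᵥ x = r • x := by
  classical
  obtain ⟨r, ⟨x, hx, hxs, hrx⟩, hmax⟩ := exists_isMax_collatzWielandt M hM
  -- Induction on the number of tight coordinates. If tight and slack ones coexist, some tight `a`
  -- has a positive entry towards a slack `b`. Passing to `x + M x` turns the slack `w` into `w + M
  -- w`, which frees `a` and makes no slack coordinate tight. If none is tight, `r` can be raised.
  have key : ∀ n : ℕ, ∀ x : V → ℝ, 0 ≤ x → 0 < ∑ i, x i → r • x ≤ M *ᵥ x →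
      (Finset.univ.filter fun i => (M *ᵥ x) i = r * x i).card = n →
      ∃ y : V → ℝ, 0 ≤ y ∧ 0 < ∑ i, y i ∧ M *ᵥ y = r • y := by
    intro n
    induction n using Nat.strong_induction_on with
    | _ n ih =>
      intro x hx hxs hrx hn
      by_cases hall : ∀ i, (M *ᵥ x) i = r * x i
      · exact ⟨x, hx, hxs, funext hall⟩
      push Not at hall
      obtain ⟨j, hj⟩ := hall
      by_cases hsome : ∃ i, (M *ᵥ x) i = r * x i
      · obtain ⟨i, hi⟩ := hsome
        have hab : ∃ a b, 0 < M a b ∧ (M *ᵥ x) a = r * x a ∧ (M *ᵥ x) b ≠ r * x b := by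
          by_contra! hcon
          have : ∀ k, Relation.ReflTransGen (fun a b => 0 < M a b) i k →
              (M *ᵥ x) k = r * x k := by
            intro k hk
            induction hk with
            | refl => exact hi
            | tail _ h2 h3 => exact hcon _ _ h2 h3
          exact hj (this j (hirr i j))
        obtain ⟨a, b, hab, ha, hb⟩ := hab
        set w : V → ℝ := M *ᵥ x - r • x with hw
        have hw0 : 0 ≤ w := sub_nonneg.2 hrx
        have hMw0 : 0 ≤ M *ᵥ w := fun i =>
          Finset.sum_nonneg fun j _ => mul_nonneg (hM i j) (hw0 j)
        have hMx0 : 0 ≤ M *ᵥ x := fun i =>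
          Finset.sum_nonneg fun j _ => mul_nonneg (hM i j) (hx j)
        have hw' : M *ᵥ (x + M *ᵥ x) - r • (x + M *ᵥ x) = w + M *ᵥ w := by
          rw [hw, mulVec_sub, mulVec_add, mulVec_smul, smul_add]; abel
        have hw'i : ∀ i, (M *ᵥ (x + M *ᵥ x)) i = r * (x + M *ᵥ x) i ↔ w i = 0 ∧ (M *ᵥ w) i = 0 := by
          intro i
          have h := congrFun hw' i
          simp only [Pi.sub_apply, Pi.add_apply, Pi.smul_apply, smul_eq_mul] at h
          rw [← sub_eq_zero, Pi.add_apply, h]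
          exact add_eq_zero_iff_of_nonneg (hw0 i) (hMw0 i)
        refine ih _ ?_ (x + M *ᵥ x) (add_nonneg hx hMx0) ?_ ?_ rfl
        · rw [← hn]
          apply Finset.card_lt_card
          rw [Finset.ssubset_iff_of_subset]
          · refine ⟨a, by simpa using ha, ?_⟩
            simp only [Finset.mem_filter, Finset.mem_univ, true_and, hw'i, not_and]
            intro _
            have hwb : 0 < w b := lt_of_le_of_ne (hw0 b) fun h => hb (by
              have : (M *ᵥ x) b - r * x b = 0 := h.symm
              linarith)
            refine ne_of_gt (lt_of_lt_of_le (mul_pos hab hwb) ?_)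
            exact Finset.single_le_sum (f := fun k => M a k * w k)
              (fun k _ => mul_nonneg (hM a k) (hw0 k)) (Finset.mem_univ b)
          · intro i
            simp only [Finset.mem_filter, Finset.mem_univ, true_and, hw'i]
            intro h
            have : (M *ᵥ x) i - r * x i = 0 := h.1
            linarith
        · simp only [Pi.add_apply, Finset.sum_add_distrib]
          exact add_pos_of_pos_of_nonneg hxs (Finset.sum_nonneg fun i _ => hMx0 i)
        · rw [← sub_nonneg, hw']
          exact add_nonneg hw0 hMw0
      · push Not at hsome
        exfalso
        have hlt : ∀ i, 0 < (M *ᵥ x) i - r * x i := fun i =>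
          sub_pos.2 (lt_of_le_of_ne (hrx i) (hsome i).symm)
        obtain ⟨m, -, hm⟩ := Finset.exists_min_image Finset.univ
          (fun i => (M *ᵥ x) i - r * x i) Finset.univ_nonempty
        set s := ∑ i, x i with hs
        -- The least slack over the total mass: as `x i ≤ s`, adding `e` to `r` costs each
        -- coordinate at most its slack.
        set e := ((M *ᵥ x) m - r * x m) / s with he
        have hepos : 0 < e := div_pos (hlt m) hxs
        have : r + e ≤ r := by
          refine hmax _ x hx hxs fun i => ?_
          have h1 : x i ≤ s := Finset.single_le_sum (fun k _ => hx k) (Finset.mem_univ i)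
          have h2 : e * x i ≤ e * s := mul_le_mul_of_nonneg_left h1 hepos.le
          have h3 : e * s = (M *ᵥ x) m - r * x m := div_mul_cancel₀ _ hxs.ne'
          have h4 := hm i (Finset.mem_univ i)
          simp only [Pi.smul_apply, smul_eq_mul]
          linarith
        linarith
  obtain ⟨y, hy, hys, hry⟩ := key _ x hx hxs hrx rfl
  refine ⟨r, y, fun i => lt_of_le_of_ne (hy i) fun h0 => ?_, hry⟩
  have hzero : ∀ k, Relation.ReflTransGen (fun a b => 0 < M a b) i k → y k = 0 := by
    intro k hk
    induction hk with
    | refl => exact h0.symm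
    | @tail a b _ hab ha =>
      have h := congrFun hry a
      simp only [Pi.smul_apply, ha, smul_zero] at h
      have h' := (Finset.sum_eq_zero_iff_of_nonneg
        (fun k _ => mul_nonneg (hM a k) (hy k))).1 h b (Finset.mem_univ b)
      exact (mul_eq_zero.1 h').resolve_left hab.ne'
  exact hys.ne' (Finset.sum_eq_zero fun k _ => hzero k (hirr i k))

/-- A real eigenvalue is at most the spectral radius. -/
theorem ofReal_le_spectralRadius_of_mulVec_eq [DecidableEq V] (M : Matrix V V ℝ) {r : ℝ}
    {x : V → ℝ} (hx : x ≠ 0) (h : M *ᵥ x = r • x) :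
    ENNReal.ofReal r ≤ spectralRadius ℂ (M.map (fun x : ℝ => (x : ℂ))) := by
  have hmem : (r : ℂ) ∈ spectrum ℂ (M.map (fun x : ℝ => (x : ℂ))) := by
    rw [← spectrum_toLin', ← Module.End.hasEigenvalue_iff_mem_spectrum]
    refine Module.End.hasEigenvalue_of_hasEigenvector (x := fun i => (x i : ℂ)) ⟨?_, fun h0 => ?_⟩
    · rw [Module.End.mem_eigenspace_iff, toLin'_apply]
      ext i
      have := congrFun h i
      simp only [mulVec, dotProduct, Pi.smul_apply, smul_eq_mul, map_apply] at this ⊢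
      exact_mod_cast this
    · exact hx (funext fun i => by simpa using congrFun h0 i)
  refine le_trans ?_ (le_iSup₂ (f := fun k _ => (‖k‖₊ : ℝ≥0∞)) (r : ℂ) hmem)
  rw [← enorm_eq_nnnorm, ← ofReal_norm, Complex.norm_real]
  exact ENNReal.ofReal_le_ofReal (le_abs_self r)

/-- A positive strict subinvariant vector of an irreducible nonnegative matrix bounds the spectral
radius strictly. -/
theorem spectralRadius_lt_of_mulVec_le [DecidableEq V] (M : Matrix V V ℝ)
    (hM : ∀ i j, 0 ≤ M i j)
    (hirr : ∀ i j, Relation.ReflTransGen (fun a b => 0 < M a b) i j) {r : ℝ} (hr : 0 < r)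
    {y : V → ℝ} (hy : ∀ i, 0 < y i) (h : M *ᵥ y ≤ r • y) {u : V} (hu : (M *ᵥ y) u < r * y u) :
    spectralRadius ℂ (M.map (fun x : ℝ => (x : ℂ))) < ENNReal.ofReal r := by
  have key : ∀ l ∈ spectrum ℂ (M.map (fun x : ℝ => (x : ℂ))), ‖l‖ < r := by
    intro l hl
    rw [← spectrum_toLin', ← Module.End.hasEigenvalue_iff_mem_spectrum] at hl
    obtain ⟨z, hz, hz0⟩ := hl.exists_hasEigenvector
    rw [Module.End.mem_eigenspace_iff, toLin'_apply] at hz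
    by_contra! hlr
    obtain ⟨i, -, hi⟩ := Finset.exists_max_image Finset.univ
      (fun i => ‖z i‖ / y i) ⟨u, Finset.mem_univ u⟩
    set c := ‖z i‖ / y i with hc
    have hzc : ∀ j, ‖z j‖ ≤ c * y j := fun j =>
      (div_le_iff₀ (hy j)).1 (hi j (Finset.mem_univ j))
    have hcpos : 0 < c := by
      obtain ⟨j, hj⟩ := Function.ne_iff.1 hz0
      have : 0 < ‖z j‖ := norm_pos_iff.2 hj
      exact (mul_pos_iff_of_pos_right (hy j)).1 (this.trans_le (hzc j))
    -- Where `‖z‖` touches `c y`, the chain `r c y ≤ ‖l‖ ‖z‖ ≤ M ‖z‖ ≤ c M y ≤ c r y` collapses to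
    -- equalities, so contact spreads along positive entries. Reaching `u` contradicts strictness
    -- there.
    have hstep : ∀ a, ‖z a‖ = c * y a →
        r * y a ≤ (M *ᵥ y) a ∧ ∀ b, 0 < M a b → ‖z b‖ = c * y b := by
      intro a ha
      have h1 : r * (c * y a) ≤ ∑ j, M a j * ‖z j‖ := by
        calc r * (c * y a) ≤ ‖l‖ * ‖z a‖ := by
              rw [← ha]; exact mul_le_mul_of_nonneg_right hlr (norm_nonneg _)
          _ = ‖∑ j, (M a j : ℂ) * z j‖ := by
              rw [← norm_mul]
              exact congrArg _ (congrFun hz a).symm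
          _ ≤ ∑ j, ‖(M a j : ℂ) * z j‖ := norm_sum_le _ _
          _ = ∑ j, M a j * ‖z j‖ := by
              refine Finset.sum_congr rfl fun j _ => ?_
              rw [norm_mul, Complex.norm_real, Real.norm_of_nonneg (hM a j)]
      have h2 : ∀ j ∈ Finset.univ, M a j * ‖z j‖ ≤ M a j * (c * y j) := fun j _ =>
        mul_le_mul_of_nonneg_left (hzc j) (hM a j)
      have h3 : ∑ j, M a j * (c * y j) = c * (M *ᵥ y) a := by
        simp only [mulVec, dotProduct, Finset.mul_sum]
        exact Finset.sum_congr rfl fun j _ => by ring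
      have h4 := Finset.sum_le_sum h2
      have h5 : c * (M *ᵥ y) a ≤ c * (r * y a) := mul_le_mul_of_nonneg_left (h a) hcpos.le
      refine ⟨le_of_mul_le_mul_left (a := c) (by linarith) hcpos, fun b hb => ?_⟩
      have h6 := (Finset.sum_eq_sum_iff_of_le h2).1 (by linarith) b (Finset.mem_univ b)
      exact mul_left_cancel₀ hb.ne' h6
    have hall : ∀ k, Relation.ReflTransGen (fun a b => 0 < M a b) i k → ‖z k‖ = c * y k := by
      intro k hk
      induction hk with
      | refl => exact (div_mul_cancel₀ _ (hy i).ne').symm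
      | tail _ hab ha => exact (hstep _ ha).2 _ hab
    exact absurd (hstep u (hall u (hirr i u))).1 (not_le.2 hu)
  -- Finiteness of the spectrum keeps the bound strict in the supremum.
  have hfin := finite_spectrum (M.map (fun x : ℝ => (x : ℂ)))
  have : spectralRadius ℂ (M.map (fun x : ℝ => (x : ℂ))) =
      hfin.toFinset.sup fun k => (‖k‖₊ : ℝ≥0∞) := by
    simp [spectralRadius, Finset.sup_eq_iSup]
  rw [this, Finset.sup_lt_iff (by simpa using hr)]
  intro l hl
  rw [← enorm_eq_nnnorm, ← ofReal_norm]
  exact (ENNReal.ofReal_lt_ofReal_iff hr).2 (key l (by simpa using hl))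

end Matrix

namespace Digraph

/-! ### The action of `A_α` arc by arc -/

section Operator

variable {V W : Type*}

open Classical in
/-- The action of `A_α(G)` on a vector, as a sum over the arcs leaving a vertex. -/
noncomputable def alphaOp [Fintype V] (α : ℝ) (G : Digraph V) (x : V → ℝ) (v : V) : ℝ :=
  ∑ w, if G.Adj v w then α * x v + (1 - α) * x w else 0

/-- In arc form the action is additive over the arcs leaving a vertex, which suits gluing. -/
theorem alphaMat_mulVec [Fintype V] [DecidableEq V] (α : ℝ) (G : Digraph V) (x : V → ℝ) :
    Matrix.mulVec (G.alphaMat α) x = G.alphaOp α x := by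
  classical
  ext v
  rw [alphaMat, Matrix.add_mulVec, Matrix.smul_mulVec, Matrix.smul_mulVec, Pi.add_apply,
    Pi.smul_apply, Pi.smul_apply, Matrix.mulVec_diagonal]
  simp only [alphaOp, outDeg, adjMat, Matrix.mulVec, dotProduct, Matrix.of_apply, smul_eq_mul,
    Finset.card_filter, Nat.cast_sum, Finset.sum_mul, Finset.mul_sum, ← Finset.sum_add_distrib]
  refine Finset.sum_congr rfl fun w _ => ?_
  split_ifs <;> simp

theorem alphaMat_nonneg [Fintype V] [DecidableEq V] {α : ℝ} (hα0 : 0 ≤ α) (hα1 : α < 1)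
    (G : Digraph V) (v w : V) : 0 ≤ G.alphaMat α v w := by
  classical
  simp only [alphaMat, adjMat, Matrix.add_apply, Matrix.smul_apply, Matrix.of_apply, smul_eq_mul,
    Matrix.diagonal_apply]
  have : 0 < 1 - α := sub_pos.2 hα1
  refine add_nonneg ?_ ?_ <;> split_ifs <;> positivity

theorem alphaMat_pos_of_adj [Fintype V] [DecidableEq V] {α : ℝ} (hα0 : 0 ≤ α) (hα1 : α < 1)
    {G : Digraph V} {v w : V} (h : G.Adj v w) : 0 < G.alphaMat α v w := by
  classical
  simp only [alphaMat, adjMat, Matrix.add_apply, Matrix.smul_apply, Matrix.of_apply, smul_eq_mul,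
    Matrix.diagonal_apply, if_pos h, mul_one]
  refine add_pos_of_nonneg_of_pos ?_ (sub_pos.2 hα1)
  split_ifs <;> positivity

theorem StronglyConnected.alphaMat_irreducible [Fintype V] [DecidableEq V] {α : ℝ}
    (hα0 : 0 ≤ α) (hα1 : α < 1) {G : Digraph V} (hG : G.StronglyConnected) (v w : V) :
    Relation.ReflTransGen (fun a b => 0 < G.alphaMat α a b) v w :=
  (hG v w).lift id fun _ _ h => alphaMat_pos_of_adj hα0 hα1 h

theorem StronglyConnected.alphaOp_pos [Fintype V] [Nontrivial V] {α : ℝ}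
    (hα0 : 0 ≤ α) (hα1 : α < 1) {G : Digraph V} (hG : G.StronglyConnected) {x : V → ℝ}
    (hx : ∀ v, 0 < x v) (v : V) : 0 < G.alphaOp α x v := by
  classical
  have hterm : ∀ w, 0 < α * x v + (1 - α) * x w := fun w =>
    add_pos_of_nonneg_of_pos (mul_nonneg hα0 (hx v).le) (mul_pos (sub_pos.2 hα1) (hx w))
  obtain ⟨w, hw⟩ := exists_ne v
  rcases (hG v w).cases_head with h | ⟨z, hz, -⟩
  · exact absurd h.symm hw
  · refine Finset.sum_pos' (fun i _ => ?_) ⟨z, Finset.mem_univ z, ?_⟩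
    · split_ifs
      exacts [(hterm i).le, le_rfl]
    · rw [if_pos hz]; exact hterm z

end Operator

/-! ### Arcs and operator of a coalescence -/

section Coalescence

variable {V W : Type*} [DecidableEq W] {G : Digraph V} {v₀ : V} {H : Digraph W} {w₀ : W}

@[simp]
theorem coalRight_self : coalRight v₀ w₀ w₀ = Sum.inl v₀ := by simp [coalRight]

@[simp]
theorem coalRight_coe (w : {w : W // w ≠ w₀}) : coalRight v₀ w₀ (w : W) = Sum.inr w := by
  simp [coalRight, w.2]

theorem coalRight_injective : Function.Injective (coalRight v₀ w₀) := by
  intro a b h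
  unfold coalRight at h
  split_ifs at h with ha hb hb
  · exact ha.trans hb.symm
  · simpa using h

theorem coalRight_eq_inl {w : W} {a : V} : coalRight v₀ w₀ w = Sum.inl a ↔ w = w₀ ∧ v₀ = a := by
  unfold coalRight
  split_ifs with h <;> simp [h]

theorem coalRight_eq_inr {w : W} {z : {w : W // w ≠ w₀}} :
    coalRight v₀ w₀ w = Sum.inr z ↔ w = z := by
  rw [← coalRight_coe (v₀ := v₀) z, coalRight_injective.eq_iff]

/-- The only arc of `H` that could land between two vertices of `G` is a loop at `w₀`. -/
theorem coalescence_adj_inl_inl (hH : ¬ H.Adj w₀ w₀) {a b : V} :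
    (coalescence G v₀ H w₀).Adj (Sum.inl a) (Sum.inl b) ↔ G.Adj a b := by
  constructor
  · rintro (⟨a', b', h, ha, hb⟩ | ⟨a', b', h, ha, hb⟩)
    · rw [Sum.inl.injEq] at ha hb
      subst ha hb; exact h
    · have h1 := (coalRight_eq_inl.1 ha.symm).1
      have h2 := (coalRight_eq_inl.1 hb.symm).1
      subst h1; subst h2; exact absurd h hH
  · exact fun h => Or.inl ⟨a, b, h, rfl, rfl⟩

theorem coalescence_adj_inl_inr {a : V} {w : {w : W // w ≠ w₀}} :
    (coalescence G v₀ H w₀).Adj (Sum.inl a) (Sum.inr w) ↔ a = v₀ ∧ H.Adj w₀ w := by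
  constructor
  · rintro (⟨a', b', h, ha, hb⟩ | ⟨a', b', h, ha, hb⟩)
    · cases hb
    · have h1 := coalRight_eq_inl.1 ha.symm
      have h2 := coalRight_eq_inr.1 hb.symm
      rw [h1.1, h2] at h
      exact ⟨h1.2.symm, h⟩
  · rintro ⟨rfl, h⟩
    exact Or.inr ⟨w₀, w, h, by simp, by simp⟩

theorem coalescence_adj_inr {w : {w : W // w ≠ w₀}} {z : W} :
    (coalescence G v₀ H w₀).Adj (Sum.inr w) (coalRight v₀ w₀ z) ↔ H.Adj w z := by
  constructor
  · rintro (⟨a', b', h, ha, hb⟩ | ⟨a', b', h, ha, hb⟩)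
    · cases ha
    · rw [coalRight_eq_inr.1 ha.symm, ← coalRight_injective hb] at h
      exact h
  · exact fun h => Or.inr ⟨w, z, h, by simp, rfl⟩

theorem coalescence_adj_inr_inl {w : {w : W // w ≠ w₀}} {a : V} :
    (coalescence G v₀ H w₀).Adj (Sum.inr w) (Sum.inl a) ↔ a = v₀ ∧ H.Adj w w₀ := by
  constructor
  · rintro (⟨a', b', h, ha, hb⟩ | ⟨a', b', h, ha, hb⟩)
    · cases ha
    · have h1 := coalRight_eq_inr.1 ha.symm
      have h2 := coalRight_eq_inl.1 hb.symm
      rw [h1, h2.1] at h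
      exact ⟨h2.2.symm, h⟩
  · rintro ⟨rfl, h⟩
    exact Or.inr ⟨w, w₀, h, by simp, by simp⟩

theorem coalescence_adj_inr_inr {w z : {w : W // w ≠ w₀}} :
    (coalescence G v₀ H w₀).Adj (Sum.inr w) (Sum.inr z) ↔ H.Adj w z := by
  rw [← coalRight_coe (v₀ := v₀) z, coalescence_adj_inr]

theorem StronglyConnected.coalescence (hG : G.StronglyConnected) (hH : H.StronglyConnected)
    (v₀ : V) (w₀ : W) : (Digraph.coalescence G v₀ H w₀).StronglyConnected := by
  have hl : ∀ a b, Relation.ReflTransGen (Digraph.coalescence G v₀ H w₀).Adj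
      (Sum.inl a) (Sum.inl b) := fun a b =>
    (hG a b).lift Sum.inl fun a b h => Or.inl ⟨a, b, h, rfl, rfl⟩
  have hr : ∀ a b, Relation.ReflTransGen (Digraph.coalescence G v₀ H w₀).Adj
      (coalRight v₀ w₀ a) (coalRight v₀ w₀ b) := fun a b =>
    (hH a b).lift (coalRight v₀ w₀) fun a b h => Or.inr ⟨a, b, h, rfl, rfl⟩
  have hto : ∀ x, Relation.ReflTransGen (Digraph.coalescence G v₀ H w₀).Adj x (Sum.inl v₀) := by
    rintro (a | w)
    · exact hl a v₀
    · simpa using hr w w₀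
  have hfrom : ∀ x, Relation.ReflTransGen (Digraph.coalescence G v₀ H w₀).Adj
      (Sum.inl v₀) x := by
    rintro (a | w)
    · exact hl v₀ a
    · simpa using hr w₀ w
  exact fun x y => (hto x).trans (hfrom y)

theorem elim_comp_coalRight {f : V → ℝ} {g : W → ℝ} (h : f v₀ = g w₀) :
    Sum.elim f (fun w : {w : W // w ≠ w₀} => g w) ∘ coalRight v₀ w₀ = g := by
  ext w
  by_cases hw : w = w₀
  · subst hw; simp [h]
  · simp [coalRight, hw]

variable [Fintype V] [Fintype W]

theorem alphaOp_coalescence_inr (α : ℝ) (x : V ⊕ {w : W // w ≠ w₀} → ℝ)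
    (w : {w : W // w ≠ w₀}) :
    (coalescence G v₀ H w₀).alphaOp α x (Sum.inr w) =
      H.alphaOp α (x ∘ coalRight v₀ w₀) w := by
  classical
  simp only [alphaOp, Fintype.sum_sum_type, coalescence_adj_inr_inl, coalescence_adj_inr_inr,
    Function.comp_apply]
  rw [Fintype.sum_eq_add_sum_subtype_ne _ w₀]
  simp only [coalRight_self, coalRight_coe]
  congr 1
  rw [Finset.sum_eq_single v₀]
  · simp
  · intro b _ hb
    simp [hb]
  · simp

theorem alphaOp_coalescence_inl_of_ne (hH : ¬ H.Adj w₀ w₀) (α : ℝ)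
    (x : V ⊕ {w : W // w ≠ w₀} → ℝ) {v : V} (hv : v ≠ v₀) :
    (coalescence G v₀ H w₀).alphaOp α x (Sum.inl v) = G.alphaOp α (x ∘ Sum.inl) v := by
  classical
  simp [alphaOp, Fintype.sum_sum_type, coalescence_adj_inl_inl hH, coalescence_adj_inl_inr, hv]

theorem alphaOp_coalescence_inl_self (hH : ¬ H.Adj w₀ w₀) (α : ℝ)
    (x : V ⊕ {w : W // w ≠ w₀} → ℝ) :
    (coalescence G v₀ H w₀).alphaOp α x (Sum.inl v₀) =
      G.alphaOp α (x ∘ Sum.inl) v₀ + H.alphaOp α (x ∘ coalRight v₀ w₀) w₀ := by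
  classical
  simp only [alphaOp, Fintype.sum_sum_type, coalescence_adj_inl_inl hH, coalescence_adj_inl_inr,
    Function.comp_apply, true_and]
  congr 1
  rw [Fintype.sum_eq_add_sum_subtype_ne _ w₀, if_neg hH]
  simp

end Coalescence

/-! ### Geometric propagation along a directed cycle -/

section Dicycle

variable {n : ℕ}

/-- The successor of a vertex of the directed cycle. -/
def dicycleNext (i : Fin n) : Fin n := ⟨((i : ℕ) + 1) % n, Nat.mod_lt _ i.pos⟩

/-- The number of arcs on the path from `b` to `i` in the directed cycle. -/
def dicycleDist (b i : Fin n) : ℕ := ((i : ℕ) + (n - b)) % n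

theorem dicycle_adj {i j : Fin n} : (dicycle n).Adj i j ↔ j = dicycleNext i := by
  simp [dicycle, dicycleNext, Fin.ext_iff]

theorem dicycleNext_ne (hn : 2 ≤ n) (i : Fin n) : dicycleNext i ≠ i := by
  intro h
  have h' : ((i : ℕ) + 1) % n = i := congrArg Fin.val h
  have hi := i.2
  rcases Nat.lt_or_ge ((i : ℕ) + 1) n with h1 | h1
  · rw [Nat.mod_eq_of_lt h1] at h'; omega
  · have : (i : ℕ) + 1 = n := by omega
    rw [this, Nat.mod_self] at h'; omega

theorem dicycle_not_adj_self (hn : 2 ≤ n) (i : Fin n) : ¬ (dicycle n).Adj i i := fun h =>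
  dicycleNext_ne hn i (dicycle_adj.1 h).symm

theorem alphaOp_dicycle (α : ℝ) (f : Fin n → ℝ) (i : Fin n) :
    (dicycle n).alphaOp α f i = α * f i + (1 - α) * f (dicycleNext i) := by
  simp [alphaOp, dicycle_adj]

theorem dicycleDist_lt (b i : Fin n) : dicycleDist b i < n := Nat.mod_lt _ b.pos

@[simp]
theorem dicycleDist_self (b : Fin n) : dicycleDist b b = 0 := by
  have hb := b.2
  have : (b : ℕ) + (n - b) = n := by omega
  simp [dicycleDist, this]

theorem dicycleDist_injective (b : Fin n) : Function.Injective (dicycleDist b) := by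
  intro i j h
  have h' : (i : ℕ) ≡ j [MOD n] := Nat.ModEq.add_right_cancel' (n - b) h
  exact Fin.ext (Nat.ModEq.eq_of_lt_of_lt h' i.2 j.2)

theorem dicycleDist_next (b i : Fin n) :
    dicycleDist b (dicycleNext i) = (dicycleDist b i + 1) % n := by
  simp only [dicycleDist, dicycleNext, Nat.mod_add_mod]
  congr 1; omega

theorem dicycleDist_pos {b i : Fin n} (h : i ≠ b) : 0 < dicycleDist b i := by
  rw [Nat.pos_iff_ne_zero]
  exact fun h0 => h (dicycleDist_injective b (h0.trans (dicycleDist_self b).symm))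

theorem dicycle_stronglyConnected : (dicycle n).StronglyConnected := by
  have key : ∀ b : Fin n, ∀ k : ℕ, ∀ i, dicycleDist b i = k →
      Relation.ReflTransGen (dicycle n).Adj b i := by
    intro b k
    induction k with
    | zero =>
      intro i hi
      rw [dicycleDist_injective b (hi.trans (dicycleDist_self b).symm)]
    | succ k ih =>
      intro i hi
      have hk : k + 1 < n := hi ▸ dicycleDist_lt b i
      set j : Fin n := ⟨((b : ℕ) + k) % n, Nat.mod_lt _ b.pos⟩ with hj
      have hjk : dicycleDist b j = k := by
        have hb := b.2
        simp only [dicycleDist, hj, Nat.mod_add_mod]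
        have : (b : ℕ) + k + (n - b) = k + n := by omega
        rw [this, Nat.add_mod_right, Nat.mod_eq_of_lt (by omega)]
      refine (ih j hjk).tail (dicycle_adj.2 (dicycleDist_injective b ?_))
      rw [dicycleDist_next, hjk, hi, Nat.mod_eq_of_lt hk]
  exact fun b i => key b _ i rfl

/-- If `f` shrinks by the factor `t⁻¹` along each inner arc of a path in the directed cycle, its
values at the ends of the path are related by a power of `t`. -/
theorem mul_apply_dicycleNext_eq {t : ℝ} {f : Fin n → ℝ} {S : Set (Fin n)}
    (hf : ∀ i, i ∉ S → f i = t * f (dicycleNext i)) (m : ℕ) :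
    ∀ i, (∀ k, 0 < k → k ≤ m → (dicycleNext^[k]) i ∉ S) →
      t * f (dicycleNext i) = t ^ (m + 1) * f ((dicycleNext^[m + 1]) i) := by
  induction m with
  | zero => intro i _; simp
  | succ m ih =>
    intro i hi
    rw [ih i fun k h1 h2 => hi k h1 (by omega), hf _ (hi (m + 1) (by omega) le_rfl),
      ← Function.iterate_succ_apply' dicycleNext (m + 1) i, ← mul_assoc, ← pow_succ]

theorem dicycleDist_iterate (b i : Fin n) (k : ℕ) :
    dicycleDist b ((dicycleNext^[k]) i) = (dicycleDist b i + k) % n := by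
  induction k with
  | zero => exact (Nat.mod_eq_of_lt (dicycleDist_lt b i)).symm
  | succ k ih => rw [Function.iterate_succ_apply', dicycleDist_next, ih, Nat.mod_add_mod]; rfl

/-- The factor `t` on the left stands for the arc leaving `b`, so the exponent is the full length of
the cycle. -/
theorem mul_apply_dicycleNext_self {t : ℝ} {f : Fin n → ℝ} {b : Fin n}
    (hf : ∀ i, i ≠ b → f i = t * f (dicycleNext i)) :
    t * f (dicycleNext b) = t ^ n * f b := by
  have hn := b.pos
  obtain ⟨m, rfl⟩ : ∃ m, n = m + 1 := ⟨n - 1, by omega⟩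
  have h := mul_apply_dicycleNext_eq (S := {b}) hf m b ?_
  · rw [h]
    congr 2
    apply dicycleDist_injective b
    rw [dicycleDist_iterate, dicycleDist_self, zero_add, Nat.mod_self]
  · intro k h1 h2 h3
    have := congrArg (dicycleDist b) (Set.mem_singleton_iff.1 h3)
    rw [dicycleDist_iterate, dicycleDist_self, zero_add, Nat.mod_eq_of_lt (by omega)] at this
    omega

/-- The vertices `b` and `c` cut the cycle into paths whose lengths add up to `n`. -/
theorem mul_apply_dicycleNext_pair {t : ℝ} {f : Fin n → ℝ} {b c : Fin n} (hcb : c ≠ b)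
    (hf : ∀ i, i ≠ b → i ≠ c → f i = t * f (dicycleNext i)) :
    t * f (dicycleNext b) = t ^ dicycleDist b c * f c ∧
      t * f (dicycleNext c) = t ^ (n - dicycleDist b c) * f b := by
  have hd := dicycleDist_pos hcb
  have hdn := dicycleDist_lt b c
  have hf' : ∀ i, i ∉ ({b, c} : Set (Fin n)) → f i = t * f (dicycleNext i) := fun i hi =>
    hf i (fun h => hi (by simp [h])) fun h => hi (by simp [h])
  obtain ⟨d, hd'⟩ : ∃ d, dicycleDist b c = d + 1 := ⟨dicycleDist b c - 1, by omega⟩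
  constructor
  · rw [mul_apply_dicycleNext_eq hf' d b, hd']
    · congr 2
      apply dicycleDist_injective b
      rw [dicycleDist_iterate, dicycleDist_self, zero_add, hd', Nat.mod_eq_of_lt (by omega)]
    · rintro k h1 h2 (h3 | h3)
      all_goals
        have := congrArg (dicycleDist b) h3
        rw [dicycleDist_iterate, dicycleDist_self, zero_add, Nat.mod_eq_of_lt (by omega)] at this
        omega
  · obtain ⟨m, hm⟩ : ∃ m, n - dicycleDist b c = m + 1 := ⟨n - dicycleDist b c - 1, by omega⟩
    rw [mul_apply_dicycleNext_eq hf' m c, hm]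
    · congr 2
      apply dicycleDist_injective b
      have : dicycleDist b c + (m + 1) = n := by omega
      rw [dicycleDist_iterate, this, Nat.mod_self, dicycleDist_self]
    · rintro k h1 h2 (h3 | h3)
      all_goals
        have := congrArg (dicycleDist b) h3
        rw [dicycleDist_iterate, Nat.mod_eq_of_lt (by omega)] at this
      · rw [dicycleDist_self] at this; omega
      · omega

/-- The function on the directed cycle with values `x` at `b` and `y` at `c` which shrinks by the
factor `t⁻¹` along all arcs leaving other vertices. -/
theorem exists_dicycle_extension {t x y : ℝ} (ht : 0 < t) (hx : 0 < x) (hy : 0 < y)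
    (b c : Fin n) (hbc : c = b → x = y) :
    ∃ f : Fin n → ℝ, (∀ i, 0 < f i) ∧ f b = x ∧ f c = y ∧
      ∀ i, i ≠ b → i ≠ c → f i = t * f (dicycleNext i) := by
  -- The exponent is the distance to the next prescribed vertex: `c` on the way from `b` to `c`, and
  -- `b` afterwards. For `c = b` the middle case never occurs.
  refine ⟨fun i => if dicycleDist b i = 0 then x else
    if dicycleDist b i ≤ dicycleDist b c then t ^ (dicycleDist b c - dicycleDist b i) * y
    else t ^ (n - dicycleDist b i) * x, fun i => ?_, by simp, ?_, fun i hib hic => ?_⟩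
  · dsimp only
    split_ifs <;> positivity
  · by_cases h : c = b
    · subst h; simp [hbc rfl]
    · simp [(dicycleDist_pos h).ne']
  · have h1 := dicycleDist_pos hib
    have h2 : dicycleDist b i ≠ dicycleDist b c := fun h => hic (dicycleDist_injective b h)
    have h3 := dicycleDist_lt b i
    have h4 := dicycleDist_lt b c
    simp only [dicycleDist_next, if_neg h1.ne']
    rcases Nat.lt_or_ge (dicycleDist b i + 1) n with h5 | h5
    · rw [Nat.mod_eq_of_lt h5, if_neg (Nat.succ_ne_zero _)]
      by_cases h6 : dicycleDist b i ≤ dicycleDist b c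
      · rw [if_pos h6, if_pos (by omega), ← mul_assoc, ← pow_succ']
        congr 2; omega
      · rw [if_neg h6, if_neg (by omega), ← mul_assoc, ← pow_succ']
        congr 2; omega
    · have h7 : dicycleDist b i + 1 = n := by omega
      have h8 : n - dicycleDist b i = 1 := by omega
      rw [h7, Nat.mod_self, if_pos rfl, if_neg (by omega), h8, pow_one]

end Dicycle

end Digraph

namespace Digraph

/-! ### The operator on `C_p · C_q · G` -/

section CycleCycle

variable {V : Type*} {p q : ℕ} {a : Fin p} {b c : Fin q}
  {hcb : c ≠ b} {G : Digraph V} {u : V}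

/-- The inclusion of `C_p` in `C_p · C_q · G`. -/
def cycleCycleFst (p : ℕ) (b : Fin q) (u : V) (i : Fin p) :
    (Fin p ⊕ {x : Fin q // x ≠ b}) ⊕ {w : V // w ≠ u} :=
  Sum.inl (Sum.inl i)

/-- The inclusion of `C_q` in `C_p · C_q · G`. -/
def cycleCycleSnd (a : Fin p) (b : Fin q) (u : V) (i : Fin q) :
    (Fin p ⊕ {x : Fin q // x ≠ b}) ⊕ {w : V // w ≠ u} :=
  Sum.inl (coalRight a b i)

theorem cycleCycleSnd_self : cycleCycleSnd a b u b = cycleCycleFst p b u a := by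
  simp [cycleCycleSnd, cycleCycleFst]

theorem cycleCycleSnd_of_ne {i : Fin q} (h : i ≠ b) :
    cycleCycleSnd a b u i = Sum.inl (Sum.inr ⟨i, h⟩) := by
  simp [cycleCycleSnd, coalRight, h]

variable [DecidableEq V]

/-- The inclusion of `G` in `C_p · C_q · G`. -/
def cycleCycleThd (p : ℕ) (b : Fin q) (c : Fin q) (hcb : c ≠ b) (u : V) (w : V) :
    (Fin p ⊕ {x : Fin q // x ≠ b}) ⊕ {w : V // w ≠ u} :=
  coalRight (Sum.inr ⟨c, hcb⟩) u w

theorem cycleCycle_stronglyConnected (hG : G.StronglyConnected) :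
    (cycleCycle p q a b c hcb G u).StronglyConnected :=
  (dicycle_stronglyConnected.coalescence dicycle_stronglyConnected a b).coalescence hG _ u

theorem cycleCycleThd_self :
    cycleCycleThd p b c hcb u u = cycleCycleSnd a b u c := by
  simp [cycleCycleThd, cycleCycleSnd_of_ne hcb]

theorem cycleCycleThd_of_ne {w : V} (h : w ≠ u) :
    cycleCycleThd p b c hcb u w = Sum.inr ⟨w, h⟩ := by
  simp [cycleCycleThd, coalRight, h]

theorem forall_cycleCycle {P : (Fin p ⊕ {x : Fin q // x ≠ b}) ⊕ {w : V // w ≠ u} → Prop}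
    (a : Fin p) (hcb : c ≠ b)
    (h1 : ∀ i, i ≠ a → P (cycleCycleFst p b u i)) (h2 : P (cycleCycleFst p b u a))
    (h3 : ∀ i, i ≠ b → i ≠ c → P (cycleCycleSnd a b u i)) (h4 : P (cycleCycleSnd a b u c))
    (h5 : ∀ w, w ≠ u → P (cycleCycleThd p b c hcb u w)) : ∀ z, P z := by
  rintro ((i | ⟨i, hi⟩) | ⟨w, hw⟩)
  · by_cases h : i = a
    · subst h; exact h2
    · exact h1 i h
  · rw [← cycleCycleSnd_of_ne (a := a) hi]
    by_cases h : i = c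
    · subst h; exact h4
    · exact h3 i hi h
  · rw [← cycleCycleThd_of_ne (hcb := hcb) hw]
    exact h5 w hw

theorem exists_cycleCycle_extension (hcb : c ≠ b) {f : Fin p → ℝ} {g : Fin q → ℝ} {h : V → ℝ}
    (hfg : f a = g b) (hgh : g c = h u) :
    ∃ x : (Fin p ⊕ {x : Fin q // x ≠ b}) ⊕ {w : V // w ≠ u} → ℝ,
      x ∘ cycleCycleFst p b u = f ∧ x ∘ cycleCycleSnd a b u = g ∧
        x ∘ cycleCycleThd p b c hcb u = h := by
  refine ⟨Sum.elim (Sum.elim f fun i => g i) fun w => h w, rfl, ?_, ?_⟩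
  · exact elim_comp_coalRight hfg
  · exact elim_comp_coalRight hgh

variable [Fintype V] (α : ℝ) (x : (Fin p ⊕ {x : Fin q // x ≠ b}) ⊕ {w : V // w ≠ u} → ℝ)

theorem alphaOp_cycleCycle_thd (hcb : c ≠ b) {w : V} (hw : w ≠ u) :
    (cycleCycle p q a b c hcb G u).alphaOp α x (cycleCycleThd p b c hcb u w) =
      G.alphaOp α (x ∘ cycleCycleThd p b c hcb u) w := by
  rw [cycleCycleThd_of_ne hw]
  exact alphaOp_coalescence_inr α x ⟨w, hw⟩

theorem alphaOp_cycleCycle_snd (hG : ¬ G.Adj u u) (hcb : c ≠ b) {i : Fin q} (hb : i ≠ b)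
    (hc : i ≠ c) :
    (cycleCycle p q a b c hcb G u).alphaOp α x (cycleCycleSnd a b u i) =
      α * x (cycleCycleSnd a b u i) + (1 - α) * x (cycleCycleSnd a b u (dicycleNext i)) := by
  have h1 : (Sum.inr ⟨i, hb⟩ : Fin p ⊕ {x : Fin q // x ≠ b}) ≠ Sum.inr ⟨c, hcb⟩ := by simpa
  have h2 := (alphaOp_coalescence_inl_of_ne
    (G := coalescence (dicycle p) a (dicycle q) b) hG α x h1).trans
      (alphaOp_coalescence_inr α (x ∘ Sum.inl) ⟨i, hb⟩)
  rw [alphaOp_dicycle] at h2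
  rw [← cycleCycleSnd_of_ne (a := a)] at h2
  exact h2

theorem alphaOp_cycleCycle_snd_root (hG : ¬ G.Adj u u) (hcb : c ≠ b) :
    (cycleCycle p q a b c hcb G u).alphaOp α x (cycleCycleSnd a b u c) =
      α * x (cycleCycleSnd a b u c) + (1 - α) * x (cycleCycleSnd a b u (dicycleNext c)) +
        G.alphaOp α (x ∘ cycleCycleThd p b c hcb u) u := by
  have h1 := alphaOp_coalescence_inl_self
    (G := coalescence (dicycle p) a (dicycle q) b) (v₀ := Sum.inr ⟨c, hcb⟩) hG α x
  have h2 := alphaOp_coalescence_inr (G := dicycle p) (H := dicycle q) (v₀ := a) α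
    (x ∘ Sum.inl) ⟨c, hcb⟩
  rw [h2, alphaOp_dicycle, ← cycleCycleSnd_of_ne (a := a)] at h1
  exact h1

theorem alphaOp_cycleCycle_fst (hq : 2 ≤ q) (hG : ¬ G.Adj u u) (hcb : c ≠ b) {i : Fin p}
    (hi : i ≠ a) :
    (cycleCycle p q a b c hcb G u).alphaOp α x (cycleCycleFst p b u i) =
      α * x (cycleCycleFst p b u i) + (1 - α) * x (cycleCycleFst p b u (dicycleNext i)) := by
  have h1 : (Sum.inl i : Fin p ⊕ {x : Fin q // x ≠ b}) ≠ Sum.inr ⟨c, hcb⟩ := by simp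
  have h2 := (alphaOp_coalescence_inl_of_ne
    (G := coalescence (dicycle p) a (dicycle q) b) hG α x h1).trans
      (alphaOp_coalescence_inl_of_ne (dicycle_not_adj_self hq b) α (x ∘ Sum.inl) hi)
  rw [alphaOp_dicycle] at h2
  exact h2

theorem alphaOp_cycleCycle_fst_root (hq : 2 ≤ q) (hG : ¬ G.Adj u u) (hcb : c ≠ b) :
    (cycleCycle p q a b c hcb G u).alphaOp α x (cycleCycleFst p b u a) =
      α * x (cycleCycleFst p b u a) + (1 - α) * x (cycleCycleFst p b u (dicycleNext a)) +
        (α * x (cycleCycleSnd a b u b) + (1 - α) * x (cycleCycleSnd a b u (dicycleNext b))) := by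
  have h1 : (Sum.inl a : Fin p ⊕ {x : Fin q // x ≠ b}) ≠ Sum.inr ⟨c, hcb⟩ := by simp
  have h2 := (alphaOp_coalescence_inl_of_ne
    (G := coalescence (dicycle p) a (dicycle q) b) hG α x h1).trans
      (alphaOp_coalescence_inl_self (dicycle_not_adj_self hq b) α (x ∘ Sum.inl))
  rw [alphaOp_dicycle, alphaOp_dicycle] at h2
  exact h2

end CycleCycle

/-! ### Reduction to the shared vertex and `G` -/

/-- A positive eigenvector of `C_p · C_q · G` reduces to the values `X` at the vertex shared by
the two cycles and `h` on `G`, with `s = r - α`, `t = (1 - α) / s` and `d` the distance from the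
shared vertex to `u`. -/
theorem exists_reduced_eigenvector {V : Type*} [Fintype V] [DecidableEq V] {α : ℝ}
    (hα0 : 0 ≤ α) (hα1 : α < 1) {G : Digraph V} (hG : G.StronglyConnected) {u : V}
    (hu : ¬ G.Adj u u) {p q : ℕ} (hq : 2 ≤ q) {a : Fin p} {b c : Fin q} (hcb : c ≠ b) :
    ∃ (s t X : ℝ) (h : V → ℝ), 0 < s ∧ 0 < t ∧ 0 < X ∧ (∀ w, 0 < h w) ∧ s * t = 1 - α ∧
      (∃ d < q, s * X = α * X + s * (t ^ p * X) + s * (t ^ d * h u) ∧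
        s * h u = s * (t ^ (q - d) * X) + G.alphaOp α h u) ∧
      (∀ w, w ≠ u → G.alphaOp α h w = (s + α) * h w) ∧
      ENNReal.ofReal (s + α) ≤ (cycleCycle p q a b c hcb G u).alphaSpectralRadius α := by
  set K := cycleCycle p q a b c hcb G u with hK
  have hKs : K.StronglyConnected := cycleCycle_stronglyConnected hG
  have : Nonempty ((Fin p ⊕ {x : Fin q // x ≠ b}) ⊕ {w : V // w ≠ u}) := ⟨Sum.inl (Sum.inl a)⟩
  obtain ⟨r, x, hx, hrx⟩ := Matrix.exists_pos_eigenvector (K.alphaMat α)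
    (alphaMat_nonneg hα0 hα1 K) (hKs.alphaMat_irreducible hα0 hα1)
  have hα1' : 0 < 1 - α := sub_pos.2 hα1
  have hop : ∀ z, K.alphaOp α x z = r * x z := fun z => by
    rw [← alphaMat_mulVec, hrx]; rfl
  have hroot := alphaOp_cycleCycle_fst_root (a := a) (G := G) α x hq hu hcb
  have hrootu := alphaOp_cycleCycle_snd_root (a := a) (G := G) α x hu hcb
  rw [hop] at hroot hrootu
  rw [cycleCycleSnd_self] at hroot
  set X := x (cycleCycleFst p b u a) with hX
  have hX0 : 0 < X := hx _
  -- Two arcs leave the shared vertex, so `r X` is `2 α X` plus positive terms.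
  have hs : 0 < r - α := by
    have h1 := mul_pos hα1' (hx (cycleCycleFst p b u (dicycleNext a)))
    have h2 := mul_pos hα1' (hx (cycleCycleSnd a b u (dicycleNext b)))
    have h3 : 0 ≤ α * X := mul_nonneg hα0 hX0.le
    have : 0 < (r - α) * X := by linarith
    exact (mul_pos_iff_of_pos_right hX0).1 this
  set s := r - α with hsdef
  set t := (1 - α) / s with htdef
  have hst : s * t = 1 - α := mul_div_cancel₀ _ hs.ne'
  have hstep : ∀ y z : ℝ, r * y = α * y + (1 - α) * z → y = t * z := by
    intro y z hyz
    apply mul_left_cancel₀ hs.ne'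
    rw [← mul_assoc, hst]
    linarith
  have hfst := mul_apply_dicycleNext_self (t := t) (f := x ∘ cycleCycleFst p b u) (b := a)
    fun i hi => hstep _ _ (by
      have := alphaOp_cycleCycle_fst (G := G) α x hq hu hcb hi
      rw [hop] at this
      exact this)
  obtain ⟨hsnd1, hsnd2⟩ := mul_apply_dicycleNext_pair (t := t) (f := x ∘ cycleCycleSnd a b u) hcb
    fun i hi hi' => hstep _ _ (by
      have := alphaOp_cycleCycle_snd (a := a) (G := G) α x hu hcb hi hi'
      rw [hop] at this
      exact this)
  simp only [Function.comp_apply, cycleCycleSnd_self] at hfst hsnd1 hsnd2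
  have hc : x (cycleCycleSnd a b u c) = (x ∘ cycleCycleThd p b c hcb u) u := by
    rw [Function.comp_apply, cycleCycleThd_self (a := a)]
  rw [← hst] at hroot hrootu
  refine ⟨s, t, X, x ∘ cycleCycleThd p b c hcb u, hs, div_pos hα1' hs, hX0, fun w => hx _, hst,
    ⟨dicycleDist b c, dicycleDist_lt b c, ?_, ?_⟩, fun w hw => ?_, ?_⟩
  · rw [← hc, ← hsnd1, ← hfst]
    linarith
  · rw [← hc, ← hsnd2]
    linarith
  · rw [← alphaOp_cycleCycle_thd (a := a) α x hcb hw, hop, hsdef, sub_add_cancel]; rfl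
  · rw [hsdef, sub_add_cancel]
    exact Matrix.ofReal_le_spectralRadius_of_mulVec_eq _
      (fun h0 => (hx (cycleCycleFst p b u a)).ne' (congrFun h0 _)) hrx

/-- A reduced subinvariant vector bounds the `α`-spectral radius of `C_p · C_q · G`. -/
theorem alphaSpectralRadius_cycleCycle_lt {V : Type*} [Fintype V] [DecidableEq V] {α : ℝ}
    (hα0 : 0 ≤ α) (hα1 : α < 1) {G : Digraph V} (hG : G.StronglyConnected) {u : V}
    (hu : ¬ G.Adj u u) {p q : ℕ} (hq : 2 ≤ q) {a : Fin p} {b c : Fin q} (hcb : c ≠ b)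
    {s t X : ℝ} {h : V → ℝ} (hs : 0 < s) (ht : 0 < t) (hX : 0 < X) (hh : ∀ w, 0 < h w)
    (hst : s * t = 1 - α)
    (hroot : s * X = α * X + s * (t ^ p * X) + s * (t ^ dicycleDist b c * h u))
    (hrootu : s * (t ^ (q - dicycleDist b c) * X) + G.alphaOp α h u < s * h u)
    (hop : ∀ w, w ≠ u → G.alphaOp α h w = (s + α) * h w) :
    (cycleCycle p q a b c hcb G u).alphaSpectralRadius α < ENNReal.ofReal (s + α) := by
  set K := cycleCycle p q a b c hcb G u with hK
  have hKs : K.StronglyConnected := cycleCycle_stronglyConnected hG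
  -- On `C_p` only the value at `a` is prescribed, so both marked vertices are `a`.
  obtain ⟨f, hf0, hfa, -, hf⟩ := exists_dicycle_extension ht hX hX a a fun _ => rfl
  obtain ⟨g, hg0, hgb, hgc, hg⟩ := exists_dicycle_extension ht hX (hh u) b c fun e => absurd e hcb
  obtain ⟨y, hyf, hyg, hyh⟩ := exists_cycleCycle_extension (a := a) hcb (hfa.trans hgb.symm) hgc
  have hyf' : ∀ i, y (cycleCycleFst p b u i) = f i := fun i => congrFun hyf i
  have hyg' : ∀ i, y (cycleCycleSnd a b u i) = g i := fun i => congrFun hyg i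
  have hyh' : ∀ i, y (cycleCycleThd p b c hcb u i) = h i := fun i => congrFun hyh i
  have hfn := mul_apply_dicycleNext_self (b := a) fun i hi => hf i hi hi
  obtain ⟨hgn, hgn'⟩ := mul_apply_dicycleNext_pair hcb hg
  rw [hfa] at hfn
  rw [hgc] at hgn
  rw [hgb] at hgn'
  have hstrict : K.alphaOp α y (cycleCycleSnd a b u c) <
      (s + α) * y (cycleCycleSnd a b u c) := by
    rw [alphaOp_cycleCycle_snd_root α y hu hcb, hyh, hyg', hyg', hgc, ← hst, mul_assoc, hgn']
    linarith
  refine Matrix.spectralRadius_lt_of_mulVec_le (K.alphaMat α) (alphaMat_nonneg hα0 hα1 K)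
    (hKs.alphaMat_irreducible hα0 hα1) (by linarith) (y := y) ?_ ?_
    (u := cycleCycleSnd a b u c) (by rw [alphaMat_mulVec]; exact hstrict)
  · refine forall_cycleCycle a hcb (fun i _ => ?_) ?_ (fun i _ _ => ?_) ?_ fun w _ => ?_
    all_goals first | rw [hyf'] | rw [hyg'] | rw [hyh']
    exacts [hf0 i, hf0 a, hg0 i, hg0 c, hh w]
  · rw [alphaMat_mulVec]
    refine forall_cycleCycle a hcb (fun i hi => ?_) ?_ (fun i hi hi' => ?_) hstrict.le
      fun w hw => ?_
    all_goals rw [Pi.smul_apply, smul_eq_mul]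
    · rw [alphaOp_cycleCycle_fst α y hq hu hcb hi, hyf', hyf', ← hst, mul_assoc,
        ← hf i hi hi]
      linarith
    · rw [alphaOp_cycleCycle_fst_root α y hq hu hcb, hyf', hyf', hyg', hyg', hfa, hgb, ← hst,
        mul_assoc, mul_assoc, hfn, hgn]
      linarith
    · rw [alphaOp_cycleCycle_snd α y hu hcb hi hi', hyg', hyg', ← hst, mul_assoc, ← hg i hi hi']
      linarith
    · rw [alphaOp_cycleCycle_thd α y hcb hw, hyh, hyh', hop w hw]

end Digraph

/-! ### Comparison of the two digraphs -/

theorem mainTheorem3 {V : Type*} [Fintype V] [DecidableEq V] [Nontrivial V]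
    (α : ℝ) (hα0 : 0 ≤ α) (hα1 : α < 1)
    (G : Digraph V) (hloop : G.Loopless) (hconn : G.StronglyConnected) (u : V)
    (p q : ℕ) (hq : 2 ≤ q) (hpq : q < p)
    (a₁ : Fin p) (b₁ c₁ : Fin q) (h₁ : c₁ ≠ b₁)
    (a₂ : Fin q) (b₂ c₂ : Fin p) (h₂ : c₂ ≠ b₂) :
    (Digraph.cycleCycle q p a₂ b₂ c₂ h₂ G u).alphaSpectralRadius α <
      (Digraph.cycleCycle p q a₁ b₁ c₁ h₁ G u).alphaSpectralRadius α := by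
  obtain ⟨s, t, X, h, hs, ht, hX, hh, hst, ⟨d, hdq, hroot, hrootu⟩, hop, hle⟩ :=
    Digraph.exists_reduced_eigenvector hα0 hα1 hconn (hloop u) hq (a := a₁) h₁
  refine lt_of_lt_of_le ?_ hle
  have hGu := hconn.alphaOp_pos hα0 hα1 hh u
  have hd : t ^ d * t ^ (q - d) = t ^ q := by rw [← pow_add]; congr 1; omega
  -- Positivity of `A_α(G) h` at `u` gives `t^(q-d) X < h u`; insert this into the equation at the
  -- shared vertex.
  have hkey : α < s * (1 - t ^ p - t ^ q) := by
    have h1 : t ^ (q - d) * X < h u := lt_of_mul_lt_mul_left (by linarith) hs.le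
    have h2 : s * (t ^ q * X) < s * (t ^ d * h u) := by
      rw [← hd, mul_assoc]; gcongr
    exact lt_of_mul_lt_mul_right (by linarith : α * X < s * (1 - t ^ p - t ^ q) * X) hX.le
  have htq : 0 < t ^ q := pow_pos ht q
  have htp : 0 < t ^ p := pow_pos ht p
  have ht1 : t < 1 := by
    by_contra! hcon
    have h1 := one_le_pow₀ hcon (n := p)
    have : s * (1 - t ^ p - t ^ q) ≤ 0 := mul_nonpos_of_nonneg_of_nonpos hs.le (by linarith)
    linarith
  have hlt : t ^ p < t ^ q := pow_lt_pow_right_of_lt_one₀ ht ht1 hpq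
  have hD' : 0 < s * (1 - t ^ p) - α := by nlinarith [mul_pos hs htq]
  have hD : 0 < s * (1 - t ^ q) - α := by nlinarith [mul_pos hs htp]
  set e := Digraph.dicycleDist b₂ c₂ with he
  have hep : e < p := Digraph.dicycleDist_lt b₂ c₂
  have he' : t ^ (p - e) * t ^ e = t ^ p := by rw [← pow_add]; congr 1; omega
  -- The value that solves the equation at the shared vertex once the cycles are exchanged.
  set Y := s * (t ^ e * h u) / (s * (1 - t ^ q) - α) with hY
  have hYD : Y * (s * (1 - t ^ q) - α) = s * (t ^ e * h u) := div_mul_cancel₀ _ hD.ne'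
  have hY0 : 0 < Y := div_pos (mul_pos hs (mul_pos (pow_pos ht e) (hh u))) hD
  refine Digraph.alphaSpectralRadius_cycleCycle_lt hα0 hα1 hconn (hloop u) (hq.trans hpq.le) h₂
    hs ht hY0 hh hst (by linarith) ?_ hop
  have hXD : X * (s * (1 - t ^ p) - α) = s * (t ^ d * h u) := by linarith
  -- The difference of the sides is `(t^q - t^p)(s(1 - t^p - t^q) - α)`.
  have hcmp : t ^ p * (s * (1 - t ^ p) - α) < t ^ q * (s * (1 - t ^ q) - α) := by
    have := mul_pos (sub_pos.2 hlt) (sub_pos.2 hkey)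
    linarith
  have hXY : t ^ (p - e) * Y < t ^ (q - d) * X := by
    have h1 : t ^ (p - e) * Y * (s * (1 - t ^ q) - α) = s * h u * t ^ p := by
      rw [mul_assoc, hYD, ← he']; ring
    have h2 : t ^ (q - d) * X * (s * (1 - t ^ p) - α) = s * h u * t ^ q := by
      rw [mul_assoc, hXD, ← hd]; ring
    rw [eq_div_iff hD.ne' |>.2 h1, eq_div_iff hD'.ne' |>.2 h2, div_lt_div_iff₀ hD hD',
      mul_assoc, mul_assoc (s * h u)]
    exact mul_lt_mul_of_pos_left hcmp (mul_pos hs (hh u))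
  have := mul_lt_mul_of_pos_left hXY hs
  linarith
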